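/- **Lattices.** Consider a rectangular array of unit cells whose edges carry labels. A configuration is *valid* if at every cell the pair of labels on the right and top edges is, in some order, the pair of labels on the left and bottom edges. The partition function with given boundary labels is the sum, over all valid configurations with this boundary, of the product of the weights of the cells. **Wavefunctions.** Let $m,w\in\{0,1\}^P$ be binary strings ($1$ = particle, $0$ = hole) such that $m$ has exactly $n$ more particles than $w$. Define $\mathrm H_{m/w}(x_1,\dots,x_n;y_1,\dots,y_P)$ as the partition function of the array with $P$ rows (numbered from top to bottom, with parameters $y_1,\dots,y_P$) and $n$ columns (numbered from left to right, with parameters $x_1,\dots,x_n$), edge labels in $\{0,1\}$, left boundary $m$, right boundary $w$ (both read from top to bottom), bottom boundary all $0$, top boundary all $1$. A cell in a row with parameter $y$ and a column with parameter $x$, with labels (left, bottom, right, top), has weight $$(1,1,1,1),\ (0,0,0,0)\mapsto 1,\qquad (0,1,0,1)\mapsto \frac{1-xy^{-1}q^{-1}}{1-xy^{-1}},\qquad (1,0,1,0)\mapsto\frac{q(1-xy^{-1}q^{-1})}{1-xy^{-1}},$$ $$(0,1,1,0)\mapsto\frac{(1-q)xy^{-1}q^{-1}}{1-xy^{-1}},\qquad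 (1,0,0,1)\mapsto\frac{1-q}{1-xy^{-1}}.$$ Put $\mathrm H_{m/w}(x_1,\dots,x_n)=\mathrm H_{m/w}(x_1,\dots,x_n;q^{-1},\dots,q^{-1})$, and $\mathrm H_m=\mathrm H_{m/w}$ when $w=(0,\dots,0)$. **Puzzles.** For $m,k\in\{0,1\}^P$ and $l,w\in\{0,1\}^N$ let $C^{k,w}_{l,m}\in\mathbb Z[q]$ be the partition function of the array with $P$ rows and $N$ columns and edge labels W (white), R (red), B (blue), with the following boundary. The $i$-th edge from the top of the left side is R if $m_i=1$ and B if $m_i=0$; the $i$-th edge from the top of the right side is W if $k_i=1$ and B if $k_i=0$; the $j$-th edge *from the right* of the top side is R if $l_j=1$ and W if $l_j=0$; the $j$-th edge from the right of the bottom side is R if $w_j=1$ and W if $w_j=0$. The fifteen possible cells (tiles), written (left, bottom, right, top), have weights - $0$: RRRR, BBBB, WWWW; - $1$: RWRW, WRWR, RWWR, WRRW, BWBW, WBWB, BWWB, WBBW, BRBR; - $q$: RBRB; - $-1$: BRRB; - $-q$: RBBR. **Theorem.** Let $P,N,n\ge 0$, let $m\in\{0,1\}^P$ have exactly $n$ particles,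 and let $l,w\in\{0,1\}^N$ be such that $l$ has exactly $n$ more particles than $w$. 1. Suppose that $m$ ends with sufficiently many holes, namely that $i+j\le P$ whenever $m_i=1$ and $l_j=1$. Then $$\mathrm H_m(x_1,\dots,x_n)\,\mathrm H_{l/w}(x_1,\dots,x_n)=\sum_{k}C^{k,w}_{l,m}(q)\,\mathrm H_k(x_1,\dots,x_n),$$ where the sum is over all $k\in\{0,1\}^P$ with exactly $n$ particles. The identity holds over every field, for all values of $q,x_1,\dots,x_n$ with $q\ne0$ and $qx_i\ne1$ for all $i$; in particular it holds as an identity of rational functions. 2. For every $k\in\{0,1\}^P$, up to an overall sign, $C^{k,w}_{l,m}$ is a polynomial in $q$ with non-negative coefficients. -/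

import Mathlib

open Polynomial

section SixVertex

/-- Conservation at a vertex of a lattice, for edge labels `left`, `bottom` (incoming) and
`right`, `top` (outgoing): the two outgoing labels are the two incoming ones, in some order.
For labels in `Bool` this gives the six vertices of the six-vertex model, and for the labels
white, red, blue the fifteen tiles of a six-vertex puzzle. -/
def Conserves {α : Type*} (left bottom right top : α) : Prop :=
  (left = right ∧ bottom = top) ∨ (left = top ∧ bottom = right)

instance {α : Type*} [DecidableEq α] (left bottom right top : α) :
    Decidable (Conserves left bottom right top) := by
  unfold Conserves; infer_instance

/-- A labelling of the edges of a rectangular lattice with `R` rows, numbered from top to bottom,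
and `C` columns, numbered from left to right. In row `i`, the horizontal edges are
`(c.1 i 0, ..., c.1 i C)` from left to right. In column `j`, the vertical edges are
`(c.2 0 j, ..., c.2 R j)` from top to bottom. -/
abbrev EdgeLabelling (α : Type*) (R C : ℕ) : Type _ :=
  (Fin R → Fin (C + 1) → α) × (Fin (R + 1) → Fin C → α)

/-- The valid configurations with given boundary: labellings satisfying conservation at every
vertex, with prescribed labels on the left and right boundary (read from top to bottom) and on the
bottom and top boundary (read from left to right). -/
def validConfigurations {α : Type*} [Fintype α] [DecidableEq α] {R C : ℕ}
    (left right : Fin R → α) (bottom top : Fin C → α) : Finset (EdgeLabelling α R C) :=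
  Finset.univ.filter fun c =>
    (∀ i, c.1 i 0 = left i) ∧ (∀ i, c.1 i (Fin.last C) = right i) ∧
    (∀ j, c.2 (Fin.last R) j = bottom j) ∧ (∀ j, c.2 0 j = top j) ∧
    ∀ i j, Conserves (c.1 i j.castSucc) (c.2 i.succ j) (c.1 i j.succ) (c.2 i.castSucc j)

/-- The partition function of a rectangular lattice with given boundary. The vertex in row `i` and
column `j` has weight `W i j left bottom right top`. -/
def partitionFunction {α A : Type*} [Fintype α] [DecidableEq α] [CommSemiring A] {R C : ℕ}
    (W : Fin R → Fin C → α → α → α → α → A)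
    (left right : Fin R → α) (bottom top : Fin C → α) : A :=
  ∑ c ∈ validConfigurations left right bottom top, ∏ i, ∏ j,
    W i j (c.1 i j.castSucc) (c.2 i.succ j) (c.1 i j.succ) (c.2 i.castSucc j)

/-- The number of particles of a binary string (`true` is a particle, `false` a hole). -/
def numParticles {P : ℕ} (m : Fin P → Bool) : ℕ :=
  (Finset.univ.filter fun i => m i = true).card

/-- The six vertex weights, with arguments in the order left, bottom, right, top; `x` is attached
to the column and `y` to the row. -/
def vertexWeight {K : Type*} [Field K] (q x y : K) : Bool → Bool → Bool → Bool → K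
  | true, true, true, true => 1
  | false, false, false, false => 1
  | false, true, false, true => (1 - x * y⁻¹ * q⁻¹) / (1 - x * y⁻¹)
  | true, false, true, false => q * (1 - x * y⁻¹ * q⁻¹) / (1 - x * y⁻¹)
  | false, true, true, false => (1 - q) * x * y⁻¹ * q⁻¹ / (1 - x * y⁻¹)
  | true, false, false, true => (1 - q) / (1 - x * y⁻¹)
  | _, _, _, _ => 0

/-- The six-vertex wavefunction `H_{m/w}(x₁, …, xₙ; y₁, …, y_P)`: the partition function with left
boundary `m`, right boundary `w`, holes on the bottom and particles on the top. -/
def waveFunctionXY {K : Type*} [Field K] (q : K) {P n : ℕ} (m w : Fin P → Bool)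
    (x : Fin n → K) (y : Fin P → K) : K :=
  partitionFunction (fun i j => vertexWeight q (x j) (y i)) m w (fun _ => false) (fun _ => true)

/-- `H_{m/w}(x₁, …, xₙ)`, the specialization of all `yᵢ` to `q⁻¹`. -/
def skewWaveFunction {K : Type*} [Field K] (q : K) {P n : ℕ} (m w : Fin P → Bool)
    (x : Fin n → K) : K :=
  waveFunctionXY q m w x fun _ => q⁻¹

/-- `H_m(x₁, …, xₙ)`, the case where `w` consists of holes. -/
def waveFunction {K : Type*} [Field K] (q : K) {P n : ℕ} (m : Fin P → Bool) (x : Fin n → K) : K :=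
  skewWaveFunction q m (fun _ => false) x

/-- The edge labels of a six-vertex puzzle. -/
inductive PuzzleLabel : Type
  | white
  | red
  | blue
  deriving DecidableEq

namespace PuzzleLabel

instance : Fintype PuzzleLabel := ⟨{white, red, blue}, fun a => by cases a <;> decide⟩

/-- The tiles of a six-vertex puzzle, that is the label patterns satisfying conservation, are
fifteen in number. -/
theorem card_tiles : (Finset.univ.filter
    fun t : PuzzleLabel × PuzzleLabel × PuzzleLabel × PuzzleLabel =>
      Conserves t.1 t.2.1 t.2.2.1 t.2.2.2).card = 15 := by
  decide

/-- The weights of the fifteen tiles, with arguments in the order left, bottom, right, top. The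
last line covers the label patterns which violate conservation and hence are not tiles. -/
def tileWeight {A : Type*} [CommRing A] (q : A) :
    PuzzleLabel → PuzzleLabel → PuzzleLabel → PuzzleLabel → A
  | red, red, red, red => 0
  | red, white, red, white => 1
  | white, red, white, red => 1
  | red, white, white, red => 1
  | white, red, red, white => 1
  | blue, blue, blue, blue => 0
  | blue, white, blue, white => 1
  | white, blue, white, blue => 1
  | blue, white, white, blue => 1
  | white, blue, blue, white => 1
  | white, white, white, white => 0
  | blue, red, blue, red => 1
  | red, blue, red, blue => q
  | blue, red, red, blue => -1
  | red, blue, blue, red => -q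
  | _, _, _, _ => 0

/-- Colouring of the top and bottom boundary strings. -/
def redWhite (b : Bool) : PuzzleLabel := if b then red else white

/-- Colouring of the left boundary string. -/
def redBlue (b : Bool) : PuzzleLabel := if b then red else blue

/-- Colouring of the right boundary string. -/
def whiteBlue (b : Bool) : PuzzleLabel := if b then white else blue

end PuzzleLabel

/-- The coefficient `C^{k,w}_{l,m}`, as a polynomial in `q` with integer coefficients: the partition
function of six-vertex puzzles with `P` rows and `N` columns, with left boundary `m` and right
boundary `k` read from top to bottom, and with top boundary `l` and bottom boundary `w` read from
right to left. -/
noncomputable def puzzleCoeff {P N : ℕ} (k : Fin P → Bool) (w l : Fin N → Bool)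
    (m : Fin P → Bool) : ℤ[X] :=
  partitionFunction (fun _ _ => PuzzleLabel.tileWeight (X : ℤ[X]))
    (fun i => PuzzleLabel.redBlue (m i)) (fun i => PuzzleLabel.whiteBlue (k i))
    (fun j => PuzzleLabel.redWhite (w j.rev)) (fun j => PuzzleLabel.redWhite (l j.rev))

end SixVertex

/-! Three bundles of lines cross pairwise: the `P` rows of the puzzle, its `N` columns, and `n`
spectral lines carrying the `xᵢ`. Rows and columns cross in puzzle tiles; spectral lines cross rows
by `rowCrossingWeight` and columns by `columnCrossingWeight`. These three weights satisfy one
Yang--Baxter equation (`yangBaxter_puzzle`), and fusing it over all three bundles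
(`YangBaxter.fuse_lattice`) says that the spectral bundle may be moved from one side of the puzzle
to the other. With rows `m` on the left and blue on the right, spectral lines entering blue and
leaving white, and columns going from `w` to `l`, this is the product rule. On one side the blue
right boundary freezes the puzzle (`puzzle_frozen`), the intermediate spectral lines are red by
conservation, and the two crossings are `H_m` and `H_{l/w}`. On the other side the hypothesis on
trailing holes prevents blue labels from entering the puzzle from below (`puzzle_bottom_ne_blue`),
so the spectral lines cross the columns trivially and leave `∑ C H_k`. The crossings are recognized
as wavefunctions by restricting three labels to two, after a quarter turn for `H_{l/w}`. For
positivity, `stringParity` is a potential on strings: the sign of a row is the sum of the potentials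
of its bottom and top strings, up to terms fixed by conservation. Interior potentials occur twice
and cancel modulo two, so all puzzles with a given boundary contribute with the same sign. -/

section Transfer

/-! ### Transfer matrices and fusion of the Yang--Baxter equation -/

variable {A : Type*} [CommSemiring A]

/-- The ordered product `M 0 * M 1 * ⋯` of a finite sequence of square matrices. -/
def chainProd {S : Type*} [Fintype S] [DecidableEq S] :
    ∀ {n : ℕ}, (Fin n → Matrix S S A) → Matrix S S A
  | 0, _ => 1
  | _ + 1, M => M 0 * chainProd fun i => M i.succ

theorem chainProd_zero {S : Type*} [Fintype S] [DecidableEq S] (M : Fin 0 → Matrix S S A) :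
    chainProd M = 1 := rfl

theorem chainProd_succ {S : Type*} [Fintype S] [DecidableEq S] {n : ℕ}
    (M : Fin (n + 1) → Matrix S S A) :
    chainProd M = M 0 * chainProd fun i => M i.succ := rfl

/-- The train argument: a crossing that passes through each vertex pair passes through the whole
line. -/
theorem chainProd_intertwine {S : Type*} [Fintype S] [DecidableEq S] {n : ℕ} (K : Matrix S S A)
    (M M' : Fin n → Matrix S S A) (h : ∀ i, K * M i = M' i * K) :
    K * chainProd M = chainProd M' * K := by
  induction n with
  | zero => simp [chainProd_zero]
  | succ n ih =>
    rw [chainProd_succ, chainProd_succ, ← mul_assoc, h 0, mul_assoc,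
      ih _ _ fun i => h i.succ, mul_assoc]

theorem sum_fin_succ_fun {α : Type*} [Fintype α] {n : ℕ} (F : (Fin (n + 1) → α) → A) :
    ∑ f, F f = ∑ a, ∑ g : Fin n → α, F (Fin.cons a g) := by
  rw [← (Fin.consEquiv fun _ : Fin (n + 1) => α).sum_comp F, Fintype.sum_prod_type]
  rfl

theorem sum_comm_four {S₁ S₂ S₃ S₄ : Type*} [Fintype S₁] [Fintype S₂] [Fintype S₃] [Fintype S₄]
    (F : S₁ → S₂ → S₃ → S₄ → A) :
    ∑ a, ∑ b, ∑ c, ∑ d, F a b c d = ∑ d, ∑ c, ∑ b, ∑ a, F a b c d := by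
  have rev : ∀ a, ∑ b, ∑ c, ∑ d, F a b c d = ∑ d, ∑ c, ∑ b, F a b c d := fun a => by
    rw [Finset.sum_congr rfl fun b _ => Finset.sum_comm (f := fun c d => F a b c d),
      Finset.sum_comm]
    exact Finset.sum_congr rfl fun _ _ => Finset.sum_comm
  rw [Finset.sum_congr rfl fun a _ => rev a, Finset.sum_comm]
  refine Finset.sum_congr rfl fun d _ => ?_
  rw [Finset.sum_comm]
  exact Finset.sum_congr rfl fun _ _ => Finset.sum_comm

/-- Gluing two parallel lines along their shared edges gives a single line whose state is a pair of
labels. This puts each side of a fused Yang--Baxter equation in the form required by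
`chainProd_intertwine`. -/
theorem sum_chainProd_mul_chainProd {S T B : Type*} [Fintype S] [DecidableEq S] [Fintype T]
    [DecidableEq T] [Fintype B] {n : ℕ} (M : Fin n → B → Matrix S S A)
    (M' : Fin n → B → Matrix T T A) (s s' : S) (t t' : T) :
    ∑ f : Fin n → B, chainProd (fun i => M i (f i)) s s' * chainProd (fun i => M' i (f i)) t t' =
      chainProd (fun i => Matrix.of fun p p' : S × T => ∑ b, M i b p.1 p'.1 * M' i b p.2 p'.2)
        (s, t) (s', t') := by
  induction n generalizing s t with
  | zero =>
    simp only [chainProd_zero, Matrix.one_apply, Prod.mk.injEq, Finset.univ_unique,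
      Finset.sum_singleton, ← ite_and, mul_ite, mul_one, mul_zero]
    simp only [and_comm]
  | succ n ih =>
    rw [sum_fin_succ_fun]
    simp only [chainProd_succ, Matrix.mul_apply, Fintype.sum_prod_type, Fin.cons_zero,
      Fin.cons_succ, Matrix.of_apply]
    simp only [← ih fun i => M i.succ]
    simp only [Finset.mul_sum, Finset.sum_mul]
    rw [sum_comm_four]
    exact Finset.sum_congr rfl fun _ _ => Finset.sum_congr rfl fun _ _ =>
      Finset.sum_congr rfl fun _ _ => Finset.sum_congr rfl fun _ _ => by ring

/-- The partition function of a row of vertices: a horizontal line with labels in `α` crossing a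
bundle of vertical lines with labels in `β`. -/
def rowWeight {α β : Type*} [Fintype α] [DecidableEq α] {n : ℕ}
    (W : Fin n → α → β → α → β → A) (a : α) (u : Fin n → β) (a' : α) (u' : Fin n → β) : A :=
  chainProd (fun j => Matrix.of fun s s' => W j s (u j) s' (u' j)) a a'

/-- The partition function of a column of vertices: a bundle of horizontal lines with labels in
`α` crossing a vertical line with labels in `β`. -/
def columnWeight {α β : Type*} [Fintype β] [DecidableEq β] {n : ℕ}
    (W : Fin n → α → β → α → β → A) (l : Fin n → α) (b : β) (r : Fin n → α) (b' : β) : A :=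
  chainProd (fun i => Matrix.of fun s s' => W i (l i) s' (r i) s) b' b

/-- The partition function of a rectangular lattice, as an iterated sum. -/
def latticeWeight {α β : Type*} [Fintype α] [DecidableEq α] [Fintype β] [DecidableEq β] {R C : ℕ}
    (W : Fin R → Fin C → α → β → α → β → A) :
    (Fin R → α) → (Fin C → β) → (Fin R → α) → (Fin C → β) → A :=
  columnWeight fun i => rowWeight (W i)

/-- The Yang--Baxter equation for the three crossings of lines labelled by `α`, `ξ` and `β`. -/
def YangBaxter {α ξ β : Type*} [Fintype α] [Fintype ξ] [Fintype β]
    (U : α → ξ → α → ξ → A) (V : α → β → α → β → A) (W : ξ → β → ξ → β → A) : Prop :=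
  ∀ a x b a'' x'' b'',
    ∑ a', ∑ x', ∑ b', U a x a' x' * V a' b a'' b' * W x' b' x'' b'' =
    ∑ a', ∑ x', ∑ b', W x b x' b' * V a b' a' b'' * U a' x' a'' x''

namespace YangBaxter

variable {α ξ β : Type*} [Fintype α] [Fintype ξ] [Fintype β]

theorem fuse_right [DecidableEq α] [DecidableEq ξ] {n : ℕ} {U : α → ξ → α → ξ → A} {V : Fin n → α → β → α → β → A}
    {W : Fin n → ξ → β → ξ → β → A} (h : ∀ j, YangBaxter U (V j) (W j)) :
    YangBaxter U (rowWeight V) (rowWeight W) := by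
  intro a x b a'' x'' b''
  have key := chainProd_intertwine
    (Matrix.of fun p p' : α × ξ => U p.1 p.2 p'.1 p'.2)
    (fun j => Matrix.of fun p p' : α × ξ =>
      ∑ c, V j p.1 (b j) p'.1 c * W j p.2 c p'.2 (b'' j))
    (fun j => Matrix.of fun p p' : α × ξ =>
      ∑ c, V j p.1 c p'.1 (b'' j) * W j p.2 (b j) p'.2 c)
    (fun j => by
      ext ⟨p, p'⟩ ⟨r, r'⟩
      have := h j p p' (b j) r r' (b'' j)
      simp only [Matrix.mul_apply, Matrix.of_apply, Fintype.sum_prod_type, Finset.mul_sum,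
        Finset.sum_mul]
      simp only [mul_assoc] at this ⊢
      rw [this]
      simp only [mul_comm, mul_left_comm])
  have e := congrFun (congrFun key (a, x)) (a'', x'')
  rw [Matrix.mul_apply, Matrix.mul_apply, Fintype.sum_prod_type, Fintype.sum_prod_type] at e
  have e1 := fun s t => sum_chainProd_mul_chainProd
    (fun j c => Matrix.of fun r r' => V j r (b j) r' c)
    (fun j c => Matrix.of fun r r' => W j r c r' (b'' j)) s a'' t x''
  have e2 := fun s t => sum_chainProd_mul_chainProd
    (fun j c => Matrix.of fun r r' => V j r c r' (b'' j))
    (fun j c => Matrix.of fun r r' => W j r (b j) r' c) a s x t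
  simp only [Matrix.of_apply] at e e1 e2
  simp only [← e1, ← e2, Finset.mul_sum, Finset.sum_mul] at e
  simp only [rowWeight, mul_assoc] at e ⊢
  rw [e]
  simp only [mul_comm, mul_left_comm, mul_assoc]

/-- The bundle lies between the two fixed lines. Since `columnWeight` runs from top to bottom, the
`α` line is followed along its direction and the `β` line against it, so the pair state holds the
left and top labels of `V`, then the right and bottom ones. -/
theorem fuse_middle [DecidableEq α] [DecidableEq β] {n : ℕ} {U : Fin n → α → ξ → α → ξ → A} {V : α → β → α → β → A}
    {W : Fin n → ξ → β → ξ → β → A} (h : ∀ j, YangBaxter (U j) V (W j)) :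
    YangBaxter (rowWeight U) V (columnWeight W) := by
  intro a x b a'' x'' b''
  have key := chainProd_intertwine
    (Matrix.of fun p p' : α × β => V p.1 p'.2 p'.1 p.2)
    (fun j => Matrix.of fun p p' : α × β =>
      ∑ c, U j p.1 c p'.1 (x'' j) * W j (x j) p'.2 c p.2)
    (fun j => Matrix.of fun p p' : α × β =>
      ∑ c, U j p.1 (x j) p'.1 c * W j c p'.2 (x'' j) p.2)
    (fun j => by
      ext ⟨p, p'⟩ ⟨r, r'⟩
      have := h j p (x j) r' r (x'' j) p'
      simp only [Matrix.mul_apply, Matrix.of_apply, Fintype.sum_prod_type, Finset.mul_sum,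
        Finset.sum_mul]
      rw [Finset.sum_congr rfl fun _ _ => Finset.sum_comm] at this
      symm at this
      rw [Finset.sum_congr rfl fun _ _ => Finset.sum_comm] at this
      simp only [mul_comm, mul_left_comm] at this ⊢
      exact this)
  have e := congrFun (congrFun key (a, b'')) (a'', b)
  rw [Matrix.mul_apply, Matrix.mul_apply, Fintype.sum_prod_type, Fintype.sum_prod_type] at e
  have e1 := fun s t => sum_chainProd_mul_chainProd
    (fun j c => Matrix.of fun r r' => U j r c r' (x'' j))
    (fun j c => Matrix.of fun r r' => W j (x j) r' c r) s a'' t b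
  have e2 := fun s t => sum_chainProd_mul_chainProd
    (fun j c => Matrix.of fun r r' => U j r (x j) r' c)
    (fun j c => Matrix.of fun r r' => W j c r' (x'' j) r) a s b'' t
  simp only [Matrix.of_apply] at e e1 e2
  simp only [← e1, ← e2, Finset.mul_sum, Finset.sum_mul] at e
  symm at e
  rw [Finset.sum_congr rfl fun _ _ => Finset.sum_comm] at e
  symm at e
  rw [Finset.sum_congr rfl fun _ _ => Finset.sum_comm] at e
  simp only [rowWeight, columnWeight, mul_comm, mul_left_comm, mul_assoc] at e ⊢
  exact e.symm

/-- Here both fixed lines are followed against their direction, hence incoming and outgoing labels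
of `W` are exchanged in the intertwiner. -/
theorem fuse_left [DecidableEq ξ] [DecidableEq β] {n : ℕ} {U : Fin n → α → ξ → α → ξ → A} {V : Fin n → α → β → α → β → A}
    {W : ξ → β → ξ → β → A} (h : ∀ j, YangBaxter (U j) (V j) W) :
    YangBaxter (columnWeight U) (columnWeight V) W := by
  have rot : ∀ {α ξ β : Type _} [Fintype α] [Fintype ξ] [Fintype β] (F : α → ξ → β → A),
      ∑ a, ∑ x, ∑ b, F a x b = ∑ x, ∑ b, ∑ a, F a x b := fun F => by
    rw [Finset.sum_comm]
    exact Finset.sum_congr rfl fun _ _ => Finset.sum_comm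
  intro a x b a'' x'' b''
  have key := chainProd_intertwine
    (Matrix.of fun p p' : ξ × β => W p'.1 p'.2 p.1 p.2)
    (fun j => Matrix.of fun p p' : ξ × β =>
      ∑ c, U j (a j) p'.1 c p.1 * V j c p'.2 (a'' j) p.2)
    (fun j => Matrix.of fun p p' : ξ × β =>
      ∑ c, U j c p'.1 (a'' j) p.1 * V j (a j) p'.2 c p.2)
    (fun j => by
      ext ⟨p, p'⟩ ⟨r, r'⟩
      have := h j (a j) r r' (a'' j) p p'
      simp only [Matrix.mul_apply, Matrix.of_apply, Fintype.sum_prod_type, Finset.mul_sum,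
        Finset.sum_mul]
      rw [rot, rot] at this
      simp only [mul_comm, mul_left_comm] at this ⊢
      exact this)
  have e := congrFun (congrFun key (x'', b'')) (x, b)
  rw [Matrix.mul_apply, Matrix.mul_apply, Fintype.sum_prod_type, Fintype.sum_prod_type] at e
  have e1 := fun s t => sum_chainProd_mul_chainProd
    (fun j c => Matrix.of fun r r' => U j (a j) r' c r)
    (fun j c => Matrix.of fun r r' => V j c r' (a'' j) r) s x t b
  have e2 := fun s t => sum_chainProd_mul_chainProd
    (fun j c => Matrix.of fun r r' => U j c r' (a'' j) r)
    (fun j c => Matrix.of fun r r' => V j (a j) r' c r) x'' s b'' t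
  simp only [Matrix.of_apply] at e e1 e2
  simp only [← e1, ← e2, Finset.mul_sum, Finset.sum_mul] at e
  rw [rot, rot]
  simp only [columnWeight, mul_comm, mul_left_comm] at e ⊢
  exact e

theorem fuse_lattice [DecidableEq α] [DecidableEq ξ] [DecidableEq β] {P n N : ℕ} {U : Fin P → Fin n → α → ξ → α → ξ → A}
    {V : Fin P → Fin N → α → β → α → β → A} {W : Fin n → Fin N → ξ → β → ξ → β → A}
    (h : ∀ i k j, YangBaxter (U i k) (V i j) (W k j)) :
    YangBaxter (latticeWeight U) (latticeWeight V) (latticeWeight W) :=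
  fuse_left fun i => fuse_middle fun k => fuse_right fun j => h i k j

end YangBaxter

end Transfer

/-! ### Partition functions as iterated transfer matrices; conservation of labels -/

section Lattice

variable {A : Type*} [CommSemiring A]

theorem chainProd_eq_sum {S : Type*} [Fintype S] [DecidableEq S] {n : ℕ}
    (M : Fin n → Matrix S S A) (s e : S) :
    chainProd M s e = ∑ h : Fin (n + 1) → S,
      if h 0 = s ∧ h (Fin.last n) = e then ∏ j, M j (h j.castSucc) (h j.succ) else 0 := by
  induction n generalizing s with
  | zero =>
    rw [sum_fin_succ_fun]
    simp only [chainProd_zero, Matrix.one_apply, Finset.univ_unique, Finset.sum_singleton,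
      Fin.cons_zero, Fin.isValue, Fin.last_zero, Finset.univ_eq_empty, Finset.prod_empty, ite_and,
      Finset.sum_ite_eq', Finset.mem_univ, if_true]
  | succ n ih =>
    rw [sum_fin_succ_fun, Finset.sum_eq_single s]
    · rw [chainProd_succ, Matrix.mul_apply]
      simp only [ih, ← Fin.succ_last, Fin.cons_succ, Fin.cons_zero, true_and,
        Fin.prod_univ_succ, Fin.castSucc_zero, ← Fin.succ_castSucc, Finset.mul_sum]
      rw [Finset.sum_comm]
      refine Finset.sum_congr rfl fun g _ => ?_
      rw [Finset.sum_eq_single (g 0)]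
      · simp
      · intro b _ hb
        simp [hb.symm]
      · simp
    · intro b _ hb
      refine Finset.sum_eq_zero fun g _ => ?_
      simp [hb]
    · simp

theorem exists_of_chainProd_succ_ne_zero {S : Type*} [Fintype S] [DecidableEq S] {n : ℕ}
    {M : Fin (n + 1) → Matrix S S A} {s e : S} (h : chainProd M s e ≠ 0) :
    ∃ m, M 0 s m ≠ 0 ∧ chainProd (fun i => M i.succ) m e ≠ 0 := by
  rw [chainProd_succ, Matrix.mul_apply] at h
  obtain ⟨m, -, hm⟩ := Finset.exists_ne_zero_of_sum_ne_zero h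
  exact ⟨m, left_ne_zero_of_mul hm, right_ne_zero_of_mul hm⟩

theorem eq_of_chainProd_ne_zero {S : Type*} [Fintype S] [DecidableEq S]
    {M : Fin 0 → Matrix S S A} {s e : S} (h : chainProd M s e ≠ 0) : s = e := by
  by_contra hne
  exact h (by rw [chainProd_zero, Matrix.one_apply_ne hne])

theorem chainProd_comp {S T : Type*} [Fintype S] [DecidableEq S] [Fintype T] [DecidableEq T]
    {n : ℕ} {ι : T → S} (hι : Function.Injective ι) (M : Fin n → Matrix S S A)
    (hM : ∀ i t s, M i (ι t) s ≠ 0 → s ∈ Set.range ι) (t t' : T) :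
    chainProd M (ι t) (ι t') = chainProd (fun i => (M i).submatrix ι ι) t t' := by
  induction n generalizing t with
  | zero => simp [chainProd_zero, Matrix.one_apply, hι.eq_iff]
  | succ n ih =>
    simp only [chainProd_succ, Matrix.mul_apply]
    refine (Fintype.sum_of_injective ι hι _ _ (fun s hs => ?_) fun r => ?_).symm
    · rw [not_not.mp (mt (hM 0 t s) hs), zero_mul]
    · rw [← ih _ fun i => hM i.succ]
      rfl

/-- A vertex weight is conserving if it vanishes at label patterns violating conservation. -/
def Conserving {α : Type*} (W : α → α → α → α → A) : Prop :=
  ∀ a b a' b', W a b a' b' ≠ 0 → Conserves a b a' b'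

/-- Configurations violating conservation have a vanishing factor, so that constraint can be
dropped; the boundary constraints are the endpoints in `chainProd_eq_sum`. -/
theorem partitionFunction_eq_latticeWeight {α : Type*} [Fintype α] [DecidableEq α] {R C : ℕ}
    (W : Fin R → Fin C → α → α → α → α → A) (hW : ∀ i j, Conserving (W i j))
    (left right : Fin R → α) (bottom top : Fin C → α) :
    partitionFunction W left right bottom top = latticeWeight W left bottom right top := by
  have e1 : partitionFunction W left right bottom top =
      ∑ v : Fin (R + 1) → Fin C → α, ∑ h : Fin R → Fin (C + 1) → α,
        if (v 0 = top ∧ v (Fin.last R) = bottom) ∧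
          ∀ i, h i 0 = left i ∧ h i (Fin.last C) = right i then
        ∏ i, ∏ j, W i j (h i j.castSucc) (v i.succ j) (h i j.succ) (v i.castSucc j) else 0 := by
    rw [partitionFunction, validConfigurations, Finset.sum_filter, Fintype.sum_prod_type,
      Finset.sum_comm]
    refine Finset.sum_congr rfl fun v _ => Finset.sum_congr rfl fun h _ => ?_
    by_cases hc : ∏ i, ∏ j, W i j (h i j.castSucc) (v i.succ j) (h i j.succ) (v i.castSucc j) = 0
    · simp [hc]
    · have hc' : ∀ i j,
          Conserves (h i j.castSucc) (v i.succ j) (h i j.succ) (v i.castSucc j) := fun i j =>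
        hW i j _ _ _ _ fun h0 => hc <| Finset.prod_eq_zero (Finset.mem_univ i) <|
          Finset.prod_eq_zero (Finset.mem_univ j) h0
      refine if_congr ?_ rfl rfl
      simp only [hc', implies_true, and_true, funext_iff, forall_and]
      tauto
  rw [e1, latticeWeight, columnWeight, chainProd_eq_sum]
  refine Finset.sum_congr rfl fun v _ => ?_
  simp only [Matrix.of_apply, rowWeight, chainProd_eq_sum, Finset.prod_univ_sum,
    Fintype.piFinset_univ, Finset.prod_ite_zero, Finset.mem_univ, true_imp_iff]
  by_cases hv : v 0 = top ∧ v (Fin.last R) = bottom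
  · simp [hv]
  · simp [hv]

/-- The number of occurrences of a label. -/
def labelCount {α : Type*} [DecidableEq α] {n : ℕ} (X : α) (u : Fin n → α) : ℕ :=
  ∑ i, if u i = X then 1 else 0

section Count

variable {α : Type*} [DecidableEq α]

theorem labelCount_succ {n : ℕ} (X : α) (u : Fin (n + 1) → α) :
    labelCount X u = (if u 0 = X then 1 else 0) + labelCount X fun i => u i.succ :=
  Fin.sum_univ_succ _

theorem labelCount_eq_zero {n : ℕ} {X : α} {u : Fin n → α} :
    labelCount X u = 0 ↔ ∀ i, u i ≠ X := by
  simp [labelCount]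

theorem labelCount_le {n : ℕ} (X : α) (u : Fin n → α) : labelCount X u ≤ n := by
  calc labelCount X u ≤ ∑ _i : Fin n, 1 := Finset.sum_le_sum fun i _ => by split_ifs <;> simp
    _ = n := by simp

theorem labelCount_eq_card {n : ℕ} {X : α} {u : Fin n → α} :
    labelCount X u = n ↔ u = fun _ => X := by
  induction n with
  | zero => exact iff_of_true rfl (Subsingleton.elim _ _)
  | succ n ih =>
    have := labelCount_le X fun i => u i.succ
    have ih' := @ih fun i => u i.succ
    rw [labelCount_succ]
    constructor
    · intro h
      split_ifs at h with h0
      · have h1 := ih'.mp (by omega)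
        funext i
        refine Fin.cases h0 (fun i => congrFun h1 i) i
      · omega
    · intro h
      subst h
      rw [if_pos rfl, ih'.mpr rfl, add_comm]

theorem labelCount_const {n : ℕ} (X : α) : labelCount X (fun _ : Fin n => X) = n :=
  labelCount_eq_card.mpr rfl

theorem labelCount_const_of_ne {n : ℕ} {X Y : α} (h : X ≠ Y) :
    labelCount Y (fun _ : Fin n => X) = 0 :=
  labelCount_eq_zero.mpr fun _ => h

theorem Conserves.count {a b a' b' : α} (h : Conserves a b a' b') (X : α) :
    (if a = X then 1 else 0) + (if b = X then 1 else 0) =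
      (if a' = X then 1 else 0) + if b' = X then 1 else 0 := by
  rcases h with ⟨rfl, rfl⟩ | ⟨rfl, rfl⟩
  · rfl
  · exact add_comm _ _

variable [Fintype α]

theorem exists_of_rowWeight_succ_ne_zero {n : ℕ} {W : Fin (n + 1) → α → α → α → α → A} {a a' : α}
    {u u' : Fin (n + 1) → α} (h : rowWeight W a u a' u' ≠ 0) :
    ∃ c, W 0 a (u 0) c (u' 0) ≠ 0 ∧
      rowWeight (fun j => W j.succ) c (fun j => u j.succ) a' (fun j => u' j.succ) ≠ 0 :=
  exists_of_chainProd_succ_ne_zero h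

theorem rowWeight_succ {n : ℕ} {W : Fin (n + 1) → α → α → α → α → A} {a a' : α}
    {u u' : Fin (n + 1) → α} :
    rowWeight W a u a' u' = ∑ c, W 0 a (u 0) c (u' 0) *
      rowWeight (fun j => W j.succ) c (fun j => u j.succ) a' (fun j => u' j.succ) := by
  rw [rowWeight, chainProd_succ, Matrix.mul_apply]
  rfl

theorem latticeWeight_succ {R C : ℕ} {W : Fin (R + 1) → Fin C → α → α → α → α → A}
    {l r : Fin (R + 1) → α} {b t : Fin C → α} :
    latticeWeight W l b r t = ∑ m, rowWeight (W 0) (l 0) m (r 0) t *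
      latticeWeight (fun j => W j.succ) (fun i => l i.succ) b (fun i => r i.succ) m := by
  rw [latticeWeight, columnWeight, chainProd_succ, Matrix.mul_apply]
  rfl

theorem exists_of_latticeWeight_succ_ne_zero {R C : ℕ}
    {W : Fin (R + 1) → Fin C → α → α → α → α → A}
    {l r : Fin (R + 1) → α} {b t : Fin C → α} (h : latticeWeight W l b r t ≠ 0) :
    ∃ m, rowWeight (W 0) (l 0) m (r 0) t ≠ 0 ∧
      latticeWeight (fun j => W j.succ) (fun i => l i.succ) b (fun i => r i.succ) m ≠ 0 := by
  rw [latticeWeight_succ] at h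
  obtain ⟨m, -, hm⟩ := Finset.exists_ne_zero_of_sum_ne_zero h
  exact ⟨m, left_ne_zero_of_mul hm, right_ne_zero_of_mul hm⟩

theorem latticeWeight_zero {C : ℕ} {W : Fin 0 → Fin C → α → α → α → α → A}
    {l r : Fin 0 → α} {b t : Fin C → α} :
    latticeWeight W l b r t = if t = b then 1 else 0 := by
  rw [latticeWeight, columnWeight, chainProd_zero, Matrix.one_apply]

theorem rowWeight_count {n : ℕ} {W : Fin n → α → α → α → α → A} (hW : ∀ j, Conserving (W j))
    {a a' : α} {u u' : Fin n → α} (h : rowWeight W a u a' u' ≠ 0) (X : α) :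
    (if a = X then 1 else 0) + labelCount X u = (if a' = X then 1 else 0) + labelCount X u' := by
  induction n generalizing a with
  | zero =>
    rw [eq_of_chainProd_ne_zero h]
    rfl
  | succ n ih =>
    obtain ⟨c, h1, h2⟩ := exists_of_rowWeight_succ_ne_zero h
    have := ih (fun j => hW j.succ) h2
    have := (hW 0 _ _ _ _ h1).count X
    rw [labelCount_succ, labelCount_succ X u']
    omega

theorem latticeWeight_count {R C : ℕ} {W : Fin R → Fin C → α → α → α → α → A}
    (hW : ∀ i j, Conserving (W i j)) {l r : Fin R → α} {b t : Fin C → α}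
    (h : latticeWeight W l b r t ≠ 0) (X : α) :
    labelCount X l + labelCount X b = labelCount X r + labelCount X t := by
  induction R generalizing t with
  | zero =>
    obtain rfl : t = b := by
      by_contra hne
      exact h (by rw [latticeWeight_zero, if_neg hne])
    simp [labelCount]
  | succ R ih =>
    obtain ⟨m, h1, h2⟩ := exists_of_latticeWeight_succ_ne_zero h
    have := ih (fun j => hW j.succ) h2
    have := rowWeight_count (hW 0) h1 X
    rw [labelCount_succ, labelCount_succ X r]
    omega

/-- By conservation a label absent from the boundary never appears inside. This is how two-label
wavefunctions are found within three-label lattices. -/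
theorem latticeWeight_comp {δ : Type*} [Fintype δ] [DecidableEq δ] {φ : δ → α}
    (hφ : Function.Injective φ) {R C : ℕ} {W : Fin R → Fin C → α → α → α → α → A}
    (hW : ∀ i j, Conserving (W i j)) (l r : Fin R → δ) (b t : Fin C → δ) :
    latticeWeight W (fun i => φ (l i)) (fun i => φ (b i)) (fun i => φ (r i)) (fun i => φ (t i)) =
      latticeWeight (fun i j a b a' b' => W i j (φ a) (φ b) (φ a') (φ b')) l b r t := by
  have inj : Function.Injective fun (u : Fin C → δ) i => φ (u i) := fun u v huv =>
    funext fun i => hφ (congrFun huv i)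
  refine (chainProd_comp inj _ (fun i t s h => ?_) t b).trans ?_
  · have key : ∀ j, s j ∈ Set.range φ := fun j => by
      by_contra hj
      have h0 := rowWeight_count (hW i) h (s j)
      have hne : ∀ d, φ d ≠ s j := fun d hd => hj ⟨d, hd⟩
      rw [if_neg (hne _), if_neg (hne _), labelCount_eq_zero.mpr fun _ => hne _] at h0
      exact labelCount_eq_zero.mp (by omega : labelCount (s j) s = 0) j rfl
    choose u hu using key
    exact ⟨u, funext hu⟩
  · refine congrFun (congrFun (congrArg chainProd ?_) t) b
    funext i
    ext u v
    refine chainProd_comp hφ _ (fun j d s h => ?_) (l i) (r i)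
    rcases hW i j _ _ _ _ h with ⟨h1, -⟩ | ⟨-, h2⟩
    · exact ⟨d, h1⟩
    · exact ⟨v j, h2⟩

end Count

/-- The quarter turn of a configuration, combined with the inversion of the horizontal labels. -/
def rotateConfiguration (R C : ℕ) : EdgeLabelling Bool R C ≃ EdgeLabelling Bool C R where
  toFun c := (fun i p => !(c.2 p.rev i), fun p j => c.1 j.rev p)
  invFun c := (fun i p => c.2 p i.rev, fun p j => !(c.1 j p.rev))
  left_inv c := by simp
  right_inv c := by simp

/-- Makes the spectral lines of `H_{l/w}` horizontal, as in their crossing with the puzzle columns.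
The turn reverses the order of the old rows, whence the reading from right to left of `l` and `w`.
-/
theorem partitionFunction_rotate {R C : ℕ} (W : Fin R → Fin C → Bool → Bool → Bool → Bool → A)
    (left right : Fin R → Bool) (bottom top : Fin C → Bool) :
    partitionFunction W left right bottom top =
      partitionFunction (fun (i : Fin C) (j : Fin R) a b a' b' => W j.rev i b' (!a) b (!a'))
        (fun i => !(bottom i)) (fun i => !(top i)) (fun j => right j.rev)
        (fun j => left j.rev) := by
  have cons : ∀ a b a' b' : Bool, Conserves a b a' b' ↔ Conserves (!b) a' (!b') a := by decide
  refine Finset.sum_equiv (rotateConfiguration R C) (fun c => ?_) fun c _ => ?_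
  · simp only [validConfigurations, Finset.mem_filter, Finset.mem_univ, true_and,
      rotateConfiguration, Equiv.coe_fn_mk, Fin.rev_zero, Fin.rev_last, Bool.not_inj_iff,
      Fin.rev_castSucc, Fin.rev_succ]
    have h1 : (∀ j : Fin R, c.1 j.rev (Fin.last C) = right j.rev) ↔
        ∀ i, c.1 i (Fin.last C) = right i :=
      (Fin.rev_surjective.forall (p := fun i => c.1 i (Fin.last C) = right i)).symm
    have h2 : (∀ j : Fin R, c.1 j.rev 0 = left j.rev) ↔ ∀ i, c.1 i 0 = left i :=
      (Fin.rev_surjective.forall (p := fun i => c.1 i 0 = left i)).symm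
    have h3 : (∀ (i : Fin C) (j : Fin R), Conserves (!(c.2 j.rev.succ i)) (c.1 j.rev i.succ)
        (!(c.2 j.rev.castSucc i)) (c.1 j.rev i.castSucc)) ↔
        ∀ i j, Conserves (c.1 i j.castSucc) (c.2 i.succ j) (c.1 i j.succ) (c.2 i.castSucc j) := by
      rw [forall_comm]
      simp only [← cons]
      exact (Fin.rev_surjective.forall (p := fun i => ∀ j : Fin C,
        Conserves (c.1 i j.castSucc) (c.2 i.succ j) (c.1 i j.succ) (c.2 i.castSucc j))).symm
    rw [h1, h2, h3]
    tauto
  · simp only [rotateConfiguration, Equiv.coe_fn_mk, Bool.not_not,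
      Fin.rev_castSucc, Fin.rev_succ]
    rw [Finset.prod_comm]
    refine Finset.prod_congr rfl fun j _ => ?_
    exact (Equiv.prod_comp Fin.revPerm fun i => W i j (c.1 i j.castSucc) (c.2 i.succ j) (c.1 i j.succ)
      (c.2 i.castSucc j)).symm

end Lattice

/-! ### The crossing weights and their Yang--Baxter equation -/

section Weights

open PuzzleLabel

/-- The weight of the crossing of a row of a puzzle with a line of parameter `x`: all pairs of
labels interact as in the six-vertex model, up to normalization by `s`. -/
def rowCrossingWeight {A : Type*} [CommRing A] (s q x : A) :
    PuzzleLabel → PuzzleLabel → PuzzleLabel → PuzzleLabel → A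
  | red, red, red, red => s * (1 - q * x)
  | blue, blue, blue, blue => s * (1 - q * x)
  | white, white, white, white => s * (1 - q * x)
  | blue, red, blue, red => s * (1 - x)
  | red, blue, red, blue => s * (q * (1 - x))
  | blue, red, red, blue => s * ((1 - q) * x)
  | red, blue, blue, red => s * (1 - q)
  | blue, white, blue, white => s * (1 - x)
  | white, blue, white, blue => s * (q * (1 - x))
  | blue, white, white, blue => s * ((1 - q) * x)
  | white, blue, blue, white => s * (1 - q)
  | red, white, red, white => s * (1 - x)
  | white, red, white, red => s * (q * (1 - x))
  | white, red, red, white => s * (1 - q)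
  | red, white, white, red => s * ((1 - q) * x)
  | _, _, _, _ => 0

/-- The weight of the crossing of a line of parameter `x` with a column of a puzzle, up to
normalization by `s`. -/
def columnCrossingWeight {A : Type*} [CommRing A] (s q x : A) :
    PuzzleLabel → PuzzleLabel → PuzzleLabel → PuzzleLabel → A
  | white, white, white, white => s * (1 - x)
  | red, red, red, red => s * (q * (1 - x))
  | blue, blue, blue, blue => s * (q * (1 - x))
  | white, red, white, red => s * (1 - q * x)
  | red, white, red, white => s * (1 - q * x)
  | white, red, red, white => s * ((1 - q) * x)
  | red, white, white, red => s * (1 - q)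
  | blue, red, blue, red => s * (1 - q * x)
  | red, blue, red, blue => s * (q * (1 - q * x))
  | blue, red, red, blue => s * (-(1 - q))
  | red, blue, blue, red => s * (-((1 - q) * x * q))
  | blue, white, blue, white => s * (1 - q * x)
  | white, blue, white, blue => s * (1 - q * x)
  | blue, white, white, blue => s * (1 - q)
  | white, blue, blue, white => s * ((1 - q) * x)
  | _, _, _, _ => 0

theorem PuzzleLabel.sum_univ {A : Type*} [AddCommMonoid A] (f : PuzzleLabel → A) :
    ∑ a, f a = f white + f red + f blue := by
  change ∑ a ∈ ({white, red, blue} : Finset PuzzleLabel), f a = _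
  rw [Finset.sum_insert (by decide), Finset.sum_insert (by decide), Finset.sum_singleton,
    add_assoc]

variable {A : Type*} [CommRing A]

theorem tileWeight_conserving (q : A) : Conserving (tileWeight q) := by
  intro a b a' b' h
  by_contra hc
  cases a <;> cases b <;> cases a' <;> cases b' <;>
    first | exact h rfl | exact hc (Or.inl ⟨rfl, rfl⟩) | exact hc (Or.inr ⟨rfl, rfl⟩)

theorem rowCrossingWeight_conserving (s q x : A) : Conserving (rowCrossingWeight s q x) := by
  intro a b a' b' h
  by_contra hc
  cases a <;> cases b <;> cases a' <;> cases b' <;>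
    first | exact h rfl | exact hc (Or.inl ⟨rfl, rfl⟩) | exact hc (Or.inr ⟨rfl, rfl⟩)

theorem columnCrossingWeight_conserving (s q x : A) :
    Conserving (columnCrossingWeight s q x) := by
  intro a b a' b' h
  by_contra hc
  cases a <;> cases b <;> cases a' <;> cases b' <;>
    first | exact h rfl | exact hc (Or.inl ⟨rfl, rfl⟩) | exact hc (Or.inr ⟨rfl, rfl⟩)

/-- Both sides vanish unless the incoming and outgoing triples agree as multisets; this cuts down
the finite check. -/
theorem YangBaxter.of_conserving {α : Type*} [Fintype α] [DecidableEq α]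
    {U V W : α → α → α → α → A} (hU : Conserving U) (hV : Conserving V) (hW : Conserving W)
    (h : ∀ a x b a'' x'' b'',
      (∀ X, (if a = X then 1 else 0) + (if x = X then 1 else 0) + (if b = X then 1 else 0) =
        (if a'' = X then 1 else 0) + (if x'' = X then 1 else 0) + (if b'' = X then 1 else 0)) →
      ∑ a', ∑ x', ∑ b', U a x a' x' * V a' b a'' b' * W x' b' x'' b'' =
      ∑ a', ∑ x', ∑ b', W x b x' b' * V a b' a' b'' * U a' x' a'' x'') :
    YangBaxter U V W := by
  intro a x b a'' x'' b''
  by_cases hc : ∀ X,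
      (if a = X then 1 else 0) + (if x = X then 1 else 0) + (if b = X then 1 else 0) =
        (if a'' = X then 1 else 0) + (if x'' = X then 1 else 0) + (if b'' = X then 1 else 0)
  · exact h _ _ _ _ _ _ hc
  · rw [Finset.sum_eq_zero fun a' _ => Finset.sum_eq_zero fun x' _ =>
      Finset.sum_eq_zero fun b' _ => ?_, Finset.sum_eq_zero fun a' _ =>
      Finset.sum_eq_zero fun x' _ => Finset.sum_eq_zero fun b' _ => ?_]
    · by_contra h0
      refine hc fun X => ?_
      have h1 := (hW _ _ _ _ (left_ne_zero_of_mul (left_ne_zero_of_mul h0))).count X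
      have h2 := (hV _ _ _ _ (right_ne_zero_of_mul (left_ne_zero_of_mul h0))).count X
      have h3 := (hU _ _ _ _ (right_ne_zero_of_mul h0)).count X
      omega
    · by_contra h0
      refine hc fun X => ?_
      have h1 := (hU _ _ _ _ (left_ne_zero_of_mul (left_ne_zero_of_mul h0))).count X
      have h2 := (hV _ _ _ _ (right_ne_zero_of_mul (left_ne_zero_of_mul h0))).count X
      have h3 := (hW _ _ _ _ (right_ne_zero_of_mul h0)).count X
      omega

set_option maxHeartbeats 1000000 in
theorem yangBaxter_puzzle (s q x : A) :
    YangBaxter (rowCrossingWeight s q x) (tileWeight q) (columnCrossingWeight s q x) := by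
  refine YangBaxter.of_conserving (rowCrossingWeight_conserving s q x) (tileWeight_conserving q)
    (columnCrossingWeight_conserving s q x) fun a y b a' y' b' hc => ?_
  -- Three labels enter and three leave, so the white and red counts determine the blue one.
  have hw := hc white
  have hr := hc red
  clear hc
  simp only [PuzzleLabel.sum_univ]
  cases a <;> cases y <;> cases b <;> cases a' <;> cases y' <;> cases b' <;>
    first
    | exact absurd hw (by decide)
    | exact absurd hr (by decide)
    | simp only [rowCrossingWeight, tileWeight, columnCrossingWeight, mul_zero, zero_mul, add_zero,
        zero_add, mul_one] <;> ring

end Weights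

/-! ### Frozen regions -/

section Freezing

variable {A : Type*} [CommSemiring A] {α : Type*} [Fintype α] [DecidableEq α]

/-- A line labelled `X` all along, crossing lines whose outgoing labels differ from `X`, does not
affect them. -/
theorem rowWeight_frozen {n : ℕ} {W : Fin n → α → α → α → α → A} (hW : ∀ j, Conserving (W j))
    {X : α} (h1 : ∀ j, ∀ y ≠ X, W j X y X y = 1) {u t : Fin n → α} (ht : ∀ i, t i ≠ X) :
    rowWeight W X u X t = if u = t then 1 else 0 := by
  induction n with
  | zero => simp [rowWeight, chainProd_zero, Subsingleton.elim u t]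
  | succ n ih =>
    have ht0 := ht 0
    rw [rowWeight_succ, Finset.sum_eq_single X]
    · rw [ih (fun j => hW j.succ) (fun j => h1 j.succ) fun i => ht i.succ]
      by_cases h0 : u 0 = t 0
      · rw [h0, h1 0 _ ht0, one_mul]
        simp [funext_iff, Fin.forall_fin_succ, h0]
      · have hz : W 0 X (u 0) X (t 0) = 0 := by
          by_contra h
          rcases hW 0 _ _ _ _ h with ⟨-, h2⟩ | ⟨h2, -⟩
          · exact h0 h2
          · exact ht0 h2.symm
        rw [hz, zero_mul, if_neg fun h => h0 (congrFun h 0)]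
    · intro c _ hc
      have hz : W 0 X (u 0) c (t 0) = 0 := by
        by_contra h
        rcases hW 0 _ _ _ _ h with ⟨h2, -⟩ | ⟨h2, -⟩
        · exact hc h2.symm
        · exact ht0 h2.symm
      rw [hz, zero_mul]
    · simp

theorem latticeWeight_frozen {R C : ℕ} {W : Fin R → Fin C → α → α → α → α → A}
    (hW : ∀ i j, Conserving (W i j)) {X : α} (h1 : ∀ i j, ∀ y ≠ X, W i j X y X y = 1)
    {b t : Fin C → α} (ht : ∀ i, t i ≠ X) :
    latticeWeight W (fun _ => X) b (fun _ => X) t = if t = b then 1 else 0 := by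
  induction R with
  | zero => exact latticeWeight_zero
  | succ R ih =>
    rw [latticeWeight_succ]
    simp only [rowWeight_frozen (hW 0) (h1 0) ht, ite_mul, one_mul, zero_mul]
    rw [Finset.sum_ite_eq', if_pos (Finset.mem_univ _)]
    exact ih (fun i => hW i.succ) fun i => h1 i.succ

/-- If the first outgoing vertical labels are all `X`, and the row does not start with `X`, then the
first incoming vertical labels are all `X` as well. -/
theorem rowWeight_eq_of_top_eq {n : ℕ} {W : Fin n → α → α → α → α → A}
    (hW : ∀ j, Conserving (W j)) {X a a' : α} {u t : Fin n → α} {J : ℕ} (ha : a ≠ X)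
    (h : rowWeight W a u a' t ≠ 0) (ht : ∀ j : Fin n, (j : ℕ) < J → t j = X) :
    ∀ j : Fin n, (j : ℕ) < J → u j = X := by
  induction n generalizing a J with
  | zero => exact fun j => j.elim0
  | succ n ih =>
    obtain ⟨c, h1, h2⟩ := exists_of_rowWeight_succ_ne_zero h
    cases J with
    | zero => simp
    | succ J =>
      have h0 : a = c ∧ u 0 = X := by
        have := ht 0 (by simp)
        rcases hW 0 _ _ _ _ h1 with ⟨h3, h4⟩ | ⟨h3, -⟩
        · exact ⟨h3, h4.trans this⟩
        · exact absurd (h3.trans this) ha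
      intro j
      refine Fin.cases (fun _ => h0.2) (fun j hj => ?_) j
      refine ih (fun j => hW j.succ) (h0.1 ▸ ha) h2 (fun j hj => ht j.succ ?_) j (J := J) ?_
      · simpa using hj
      · simpa using hj

/-- If a row starts with `X`, the first `s` outgoing vertical labels differ from `X`, and lines
labelled `X` cannot meet, then the first `s + 1` incoming vertical labels differ from `X`. -/
theorem rowWeight_ne_of_top_ne {n : ℕ} {W : Fin n → α → α → α → α → A}
    (hW : ∀ j, Conserving (W j)) {X a' : α} (hX : ∀ j c d, W j X X c d = 0) {u t : Fin n → α}
    {s : ℕ} (h : rowWeight W X u a' t ≠ 0) (ht : ∀ j : Fin n, (j : ℕ) < s → t j ≠ X) :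
    ∀ j : Fin n, (j : ℕ) < s + 1 → u j ≠ X := by
  induction n generalizing s with
  | zero => exact fun j => j.elim0
  | succ n ih =>
    obtain ⟨c, h1, h2⟩ := exists_of_rowWeight_succ_ne_zero h
    have h0 : u 0 ≠ X := fun h0 => h1 (by rw [h0, hX])
    intro j
    refine Fin.cases (fun _ => h0) (fun j hj => ?_) j
    cases s with
    | zero => simp at hj
    | succ s =>
      have hc : X = c := by
        rcases hW 0 _ _ _ _ h1 with ⟨h3, -⟩ | ⟨h3, -⟩
        · exact h3
        · exact absurd h3.symm (ht 0 (by simp))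
      subst hc
      refine ih (fun j => hW j.succ) (fun j => hX j.succ) (s := s) h2
        (fun j hj => ht j.succ ?_) j ?_
      · simpa using hj
      · simpa using hj

/-- Going down the rows, let `s` be the length of an initial segment known to avoid `X`. A row
starting with `X` lengthens it by one. Any other row may reset it to `J`, the initial segment of
`Y`'s being preserved throughout; `hlJ` says that enough rows then remain to reach length `C`. -/
theorem latticeWeight_bottom_ne {R C : ℕ} {W : Fin R → Fin C → α → α → α → α → A}
    (hW : ∀ i j, Conserving (W i j)) {X Y : α} (hX : ∀ i j c d, W i j X X c d = 0)
    {l r : Fin R → α} {b t : Fin C → α} {J s : ℕ} (h : latticeWeight W l b r t ≠ 0)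
    (hl : ∀ i, l i ≠ Y) (hXY : X ≠ Y) (hJ : ∀ j : Fin C, (j : ℕ) < J → t j = Y)
    (hs : ∀ j : Fin C, (j : ℕ) < s → t j ≠ X) (hsR : C ≤ s + R)
    (hlJ : ∀ i : Fin R, l i ≠ X → C + i + 1 ≤ J + R) : ∀ j, b j ≠ X := by
  induction R generalizing t s with
  | zero =>
    intro j
    have htb : t = b := by
      by_contra hne
      exact h (by rw [latticeWeight_zero, if_neg hne])
    rw [← htb]
    exact hs j (by omega)
  | succ R ih =>
    obtain ⟨m, h1, h2⟩ := exists_of_latticeWeight_succ_ne_zero h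
    have hm := rowWeight_eq_of_top_eq (hW 0) (hl 0) h1 hJ
    have hlJ' : ∀ i : Fin R, l i.succ ≠ X → C + i + 1 ≤ J + R := fun i hi => by
      have := hlJ i.succ hi
      rw [Fin.val_succ] at this
      omega
    by_cases h0 : l 0 = X
    · rw [h0] at h1
      exact ih (s := s + 1) (fun i => hW i.succ) (fun i => hX i.succ) h2 (fun i => hl i.succ) hm
        (rowWeight_ne_of_top_ne (hW 0) (hX 0) h1 hs) (by omega) hlJ'
    · have := hlJ 0 h0
      rw [Fin.val_zero] at this
      exact ih (s := J) (fun i => hW i.succ) (fun i => hX i.succ) h2 (fun i => hl i.succ) hm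
        (fun j hj => hm j hj ▸ hXY.symm) (by omega) hlJ'

end Freezing

/-! ### Wavefunctions and puzzle coefficients as three-label lattices -/

section ProductRule

open PuzzleLabel

theorem Conserving.comp {A : Type*} [CommSemiring A] {α δ : Type*} {W : α → α → α → α → A}
    (hW : Conserving W) {φ : δ → α} (hφ : Function.Injective φ) :
    Conserving fun a b a' b' => W (φ a) (φ b) (φ a') (φ b') := fun a b a' b' h => by
  rcases hW _ _ _ _ h with ⟨h1, h2⟩ | ⟨h1, h2⟩
  · exact Or.inl ⟨hφ h1, hφ h2⟩
  · exact Or.inr ⟨hφ h1, hφ h2⟩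

theorem labelCount_comp {α δ : Type*} [DecidableEq α] [DecidableEq δ] {φ : δ → α}
    (hφ : Function.Injective φ) {n : ℕ} (X : δ) (u : Fin n → δ) :
    labelCount (φ X) (fun i => φ (u i)) = labelCount X u := by
  simp only [labelCount, hφ.eq_iff]

theorem numParticles_eq_labelCount {P : ℕ} (m : Fin P → Bool) :
    numParticles m = labelCount true m := by
  rw [numParticles, labelCount, Finset.card_filter]

theorem partitionFunction_comp {A : Type*} [CommSemiring A] {α δ : Type*} [Fintype α]
    [DecidableEq α] [Fintype δ] [DecidableEq δ] {R C : ℕ} {W : Fin R → Fin C → α → α → α → α → A}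
    (hW : ∀ i j, Conserving (W i j)) {φ : δ → α} (hφ : Function.Injective φ)
    (left right : Fin R → δ) (bottom top : Fin C → δ) :
    partitionFunction (fun i j a b a' b' => W i j (φ a) (φ b) (φ a') (φ b')) left right bottom top =
      latticeWeight W (fun i => φ (left i)) (fun j => φ (bottom j)) (fun i => φ (right i))
        (fun j => φ (top j)) := by
  rw [partitionFunction_eq_latticeWeight _ fun i j => (hW i j).comp hφ, latticeWeight_comp hφ hW]

theorem redWhite_injective : Function.Injective redWhite := by decide
theorem redBlue_injective : Function.Injective redBlue := by decide
theorem whiteBlue_injective : Function.Injective whiteBlue := by decide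

variable {K : Type*} [Field K] {q : K}

/-- At `y = q⁻¹` all denominators become `1 - q * x`, which is the normalization `s⁻¹`. -/
theorem vertexWeight_eq_redBlue (hq : q ≠ 0) (x : K) (a b a' b' : Bool) (hx : 1 - q * x ≠ 0) :
    vertexWeight q x q⁻¹ a b a' b' =
      rowCrossingWeight (1 - q * x)⁻¹ q x (redBlue a) (redBlue b) (redBlue a') (redBlue b') := by
  have hx' : 1 - x * q ≠ 0 := by rwa [mul_comm]
  cases a <;> cases b <;> cases a' <;> cases b' <;>
    simp [vertexWeight, rowCrossingWeight, redBlue, hx] <;> field_simp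

theorem vertexWeight_eq_whiteBlue (hq : q ≠ 0) (x : K) (a b a' b' : Bool) (hx : 1 - q * x ≠ 0) :
    vertexWeight q x q⁻¹ a b a' b' = rowCrossingWeight (1 - q * x)⁻¹ q x
      (whiteBlue a) (whiteBlue b) (whiteBlue a') (whiteBlue b') := by
  have hx' : 1 - x * q ≠ 0 := by rwa [mul_comm]
  cases a <;> cases b <;> cases a' <;> cases b' <;>
    simp [vertexWeight, rowCrossingWeight, whiteBlue, hx] <;> field_simp

theorem vertexWeight_eq_redWhite (hq : q ≠ 0) (x : K) (a b a' b' : Bool) (hx : 1 - q * x ≠ 0) :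
    vertexWeight q x q⁻¹ b' (!a) b (!a') = columnCrossingWeight (1 - q * x)⁻¹ q x
      (redWhite a) (redWhite b) (redWhite a') (redWhite b') := by
  have hx' : 1 - x * q ≠ 0 := by rwa [mul_comm]
  cases a <;> cases b <;> cases a' <;> cases b' <;>
    simp [vertexWeight, columnCrossingWeight, redWhite, hx] <;> field_simp

variable {P N n : ℕ} {x : Fin n → K}

theorem waveFunction_eq_redBlue (hq : q ≠ 0) (hx : ∀ i, 1 - q * x i ≠ 0) (m : Fin P → Bool) :
    waveFunction q m x =
      latticeWeight (fun _ k => rowCrossingWeight (1 - q * x k)⁻¹ q (x k))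
        (fun i => redBlue (m i)) (fun _ => blue) (fun _ => blue) (fun _ => red) := by
  refine Eq.trans ?_ (partitionFunction_comp (fun i j => rowCrossingWeight_conserving _ _ _)
    redBlue_injective m (fun _ => false) (fun _ => false) (fun _ => true))
  rw [waveFunction, skewWaveFunction, waveFunctionXY]
  congr 1
  funext i j a b a' b'
  exact vertexWeight_eq_redBlue hq _ _ _ _ _ (hx j)

theorem waveFunction_eq_whiteBlue (hq : q ≠ 0) (hx : ∀ i, 1 - q * x i ≠ 0) (m : Fin P → Bool) :
    waveFunction q m x =
      latticeWeight (fun _ k => rowCrossingWeight (1 - q * x k)⁻¹ q (x k))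
        (fun i => whiteBlue (m i)) (fun _ => blue) (fun _ => blue) (fun _ => white) := by
  refine Eq.trans ?_ (partitionFunction_comp (fun i j => rowCrossingWeight_conserving _ _ _)
    whiteBlue_injective m (fun _ => false) (fun _ => false) (fun _ => true))
  rw [waveFunction, skewWaveFunction, waveFunctionXY]
  congr 1
  funext i j a b a' b'
  exact vertexWeight_eq_whiteBlue hq _ _ _ _ _ (hx j)

theorem skewWaveFunction_eq_redWhite (hq : q ≠ 0) (hx : ∀ i, 1 - q * x i ≠ 0)
    (l w : Fin N → Bool) :
    skewWaveFunction q l w x =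
      latticeWeight (fun k _ => columnCrossingWeight (1 - q * x k)⁻¹ q (x k))
        (fun _ => red) (fun j => redWhite (w j.rev)) (fun _ => white)
        (fun j => redWhite (l j.rev)) := by
  refine Eq.trans ?_ (partitionFunction_comp (fun i j => columnCrossingWeight_conserving _ _ _)
    redWhite_injective (fun _ => true) (fun _ => false) (fun j => w j.rev) (fun j => l j.rev))
  rw [skewWaveFunction, waveFunctionXY, partitionFunction_rotate]
  congr 1
  funext i j a b a' b'
  exact vertexWeight_eq_redWhite hq _ _ _ _ _ (hx i)

theorem puzzleCoeff_eq_latticeWeight (k : Fin P → Bool) (w l : Fin N → Bool) (m : Fin P → Bool) :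
    puzzleCoeff k w l m = latticeWeight (fun _ _ => tileWeight X) (fun i => redBlue (m i))
      (fun j => redWhite (w j.rev)) (fun i => whiteBlue (k i)) (fun j => redWhite (l j.rev)) :=
  partitionFunction_eq_latticeWeight _ (fun _ _ => tileWeight_conserving _) _ _ _ _

theorem aeval_tileWeight {B : Type*} [CommRing B] (q : B) (a b a' b' : PuzzleLabel) :
    aeval q (tileWeight (X : ℤ[X]) a b a' b') = tileWeight q a b a' b' := by
  cases a <;> cases b <;> cases a' <;> cases b' <;> simp [tileWeight]

theorem aeval_puzzleCoeff {B : Type*} [CommRing B] (q : B) (k : Fin P → Bool)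
    (w l : Fin N → Bool) (m : Fin P → Bool) :
    aeval q (puzzleCoeff k w l m) = latticeWeight (fun _ _ => tileWeight q)
      (fun i => redBlue (m i)) (fun j => redWhite (w j.rev)) (fun i => whiteBlue (k i))
      (fun j => redWhite (l j.rev)) := by
  rw [← partitionFunction_eq_latticeWeight _ fun _ _ => tileWeight_conserving q, puzzleCoeff,
    partitionFunction, partitionFunction, map_sum]
  simp only [map_prod, aeval_tileWeight]

end ProductRule

/-! ### The product rule -/

section ProductRule

open PuzzleLabel

theorem sum_eq_of_forall_ne_zero {A S T U : Type*} [AddCommMonoid A] [Fintype S] [Fintype T]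
    [Fintype U] {F : S → T → U → A} {s : S} {t : T} {u : U}
    (h : ∀ s' t' u', F s' t' u' ≠ 0 → s' = s ∧ t' = t ∧ u' = u) :
    ∑ s', ∑ t', ∑ u', F s' t' u' = F s t u := by
  rw [Finset.sum_eq_single s, Finset.sum_eq_single t, Finset.sum_eq_single u]
  · exact fun u' _ hu => not_not.mp fun h0 => hu (h _ _ _ h0).2.2
  · simp
  · exact fun t' _ ht => Finset.sum_eq_zero fun u' _ => not_not.mp fun h0 => ht (h _ _ _ h0).2.1
  · simp
  · exact fun s' _ hs => Finset.sum_eq_zero fun t' _ => Finset.sum_eq_zero fun u' _ =>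
      not_not.mp fun h0 => hs (h _ _ _ h0).1
  · simp

theorem redWhite_ne_blue (b : Bool) : redWhite b ≠ blue := by cases b <;> decide
theorem redBlue_ne_white (b : Bool) : redBlue b ≠ white := by cases b <;> decide

variable {P N n : ℕ}

/-- A puzzle with blue right boundary is frozen. -/
theorem puzzle_frozen {A : Type*} [CommRing A] {q : A} {a : Fin P → PuzzleLabel}
    {b t : Fin N → PuzzleLabel} (hb : ∀ j, b j ≠ blue)
    (h : latticeWeight (fun _ _ => tileWeight q) a b (fun _ => blue) t ≠ 0) :
    a = (fun _ => blue) ∧ t = b := by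
  -- The right side already has the maximal number `P` of blue labels and none enter from below, so
  -- the left side must be all blue and none can leave at the top.
  have hc := latticeWeight_count (fun _ _ => tileWeight_conserving q) h blue
  rw [labelCount_const, labelCount_eq_zero.mpr hb] at hc
  have := labelCount_le blue a
  have ha : a = fun _ => blue := labelCount_eq_card.mp (by omega)
  have ht : ∀ j, t j ≠ blue := labelCount_eq_zero.mp (by omega)
  subst ha
  refine ⟨rfl, by_contra fun hne => h ?_⟩
  rw [latticeWeight_frozen (fun _ _ => tileWeight_conserving q) _ ht, if_neg hne]
  intro _ _ y hy
  cases y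
  · rfl
  · rfl
  · exact absurd rfl hy

theorem puzzle_frozen_weight {A : Type*} [CommRing A] {q : A} {b : Fin N → PuzzleLabel}
    (hb : ∀ j, b j ≠ blue) :
    latticeWeight (fun (_ : Fin P) _ => tileWeight q) (fun _ => blue) b (fun _ => blue) b = 1 := by
  rw [latticeWeight_frozen (fun _ _ => tileWeight_conserving q) _ hb, if_pos rfl]
  intro _ _ y hy
  cases y
  · rfl
  · rfl
  · exact absurd rfl hy

/-- If the left boundary ends with sufficiently many holes, then no line can enter the puzzle from
below with a blue label. -/
theorem puzzle_bottom_ne_blue {A : Type*} [CommRing A] {q : A} {m : Fin P → Bool}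
    {l : Fin N → Bool}
    (h : ∀ (i : Fin P) (j : Fin N), m i = true → l j = true → (i + 1 : ℕ) + (j + 1 : ℕ) ≤ P)
    {b : Fin N → PuzzleLabel} {r : Fin P → PuzzleLabel}
    (h0 : latticeWeight (fun _ _ => tileWeight q) (fun i => redBlue (m i)) b r
      (fun j => redWhite (l j.rev)) ≠ 0) : ∀ j, b j ≠ blue := by
  -- `M` is the last particle position of `l`, counted from one (zero if there is none). The top is
  -- read from right to left, so its first `N - M` labels are white, and the hypothesis says that
  -- `M` rows or more lie below each particle of `m`.
  set M := Finset.univ.sup fun j : Fin N => if l j = true then (j : ℕ) + 1 else 0 with hM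
  have hMN : M ≤ N := Finset.sup_le fun j _ => by split_ifs <;> omega
  refine latticeWeight_bottom_ne (fun _ _ => tileWeight_conserving q) (Y := white) (J := N - M)
    (s := N) ?_ h0 (fun i => redBlue_ne_white _) (by decide) ?_
    (fun j _ => redWhite_ne_blue _) (by omega) ?_
  · intro _ _ c d
    cases c <;> cases d <;> rfl
  · intro j hj
    have hl : l j.rev = false := by
      by_contra hl
      have : _ ≤ M := Finset.le_sup (f := fun j : Fin N => if l j = true then (j : ℕ) + 1 else 0)
        (Finset.mem_univ j.rev)
      rw [if_pos (by simpa using hl), Fin.val_rev] at this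
      omega
    rw [hl]
    rfl
  · intro i hi
    have hm : m i = true := by
      by_contra hm
      exact hi (by rw [Bool.not_eq_true] at hm; rw [hm]; rfl)
    have : M ≤ P - (i + 1) := Finset.sup_le fun j _ => by
      split_ifs with hl
      · have := h i j hm hl
        omega
      · omega
    omega

variable {K : Type*} [Field K] {q : K} {x : Fin n → K}

/-- A blue spectral line crosses red and white columns with weight `s * (1 - q * x) = 1`. -/
theorem columnCrossing_frozen (hx : ∀ i, 1 - q * x i ≠ 0) {b t : Fin N → PuzzleLabel}
    (ht : ∀ j, t j ≠ blue) :
    latticeWeight (fun k _ => columnCrossingWeight (1 - q * x k)⁻¹ q (x k)) (fun _ => blue) b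
      (fun _ => blue) t = if t = b then 1 else 0 := by
  refine latticeWeight_frozen (fun _ _ => columnCrossingWeight_conserving _ _ _) ?_ ht
  intro k _ y hy
  cases y
  · exact inv_mul_cancel₀ (hx k)
  · exact inv_mul_cancel₀ (hx k)
  · exact absurd rfl hy

theorem waveFunction_mul_skewWaveFunction (m : Fin P → Bool) (w l : Fin N → Bool)
    (hm : numParticles m = n)
    (h : ∀ (i : Fin P) (j : Fin N), m i = true → l j = true → (i + 1 : ℕ) + (j + 1 : ℕ) ≤ P)
    (hq : q ≠ 0) (hx : ∀ i, 1 - q * x i ≠ 0) :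
    waveFunction q m x * skewWaveFunction q l w x =
      ∑ k : Fin P → Bool with numParticles k = n,
        aeval q (puzzleCoeff k w l m) * waveFunction q k x := by
  have hwb : ∀ j : Fin N, redWhite (w j.rev) ≠ blue := fun _ => redWhite_ne_blue _
  have ybe := YangBaxter.fuse_lattice
    (fun (_ : Fin P) (k : Fin n) (_ : Fin N) => yangBaxter_puzzle (1 - q * x k)⁻¹ q (x k))
    (fun i => redBlue (m i)) (fun _ => blue) (fun j => redWhite (w j.rev))
    (fun _ => blue) (fun _ => white) (fun j => redWhite (l j.rev))
  have hU : ∀ (_ : Fin P) (k : Fin n),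
      Conserving (rowCrossingWeight (1 - q * x k)⁻¹ q (x k)) := fun _ _ =>
    rowCrossingWeight_conserving _ _ _
  rw [sum_eq_of_forall_ne_zero (s := fun _ => blue) (t := fun _ => red)
    (u := fun j => redWhite (w j.rev))] at ybe
  · rw [puzzle_frozen_weight hwb, mul_one, ← waveFunction_eq_redBlue hq hx,
      ← skewWaveFunction_eq_redWhite hq hx] at ybe
    rw [ybe]
    -- The sum over `a'` must survive and become the sum over `k`; the dummy `Unit` index allows
    -- only the other two sums to be collapsed.
    have key : ∀ a' : Fin P → PuzzleLabel, _ = _ := fun a' => sum_eq_of_forall_ne_zero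
      (S := Unit) (s := ()) (t := fun _ => blue) (u := fun j => redWhite (w j.rev))
      (F := fun _ x' b' => latticeWeight
          (fun (k : Fin n) (_ : Fin N) => columnCrossingWeight (1 - q * x k)⁻¹ q (x k))
          (fun _ => blue) (fun j => redWhite (w j.rev)) x' b' *
        latticeWeight (fun _ _ => tileWeight q) (fun i => redBlue (m i)) b' a'
          (fun j => redWhite (l j.rev)) *
        latticeWeight (fun (_ : Fin P) k => rowCrossingWeight (1 - q * x k)⁻¹ q (x k)) a' x'
          (fun _ => blue) (fun _ => white)) ?_
    · simp only [Finset.univ_unique, Finset.sum_singleton] at key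
      simp only [key]
      rw [columnCrossing_frozen hx hwb, if_pos rfl, Finset.sum_filter]
      refine (Fintype.sum_of_injective (fun (k : Fin P → Bool) i => whiteBlue (k i))
        (fun k k' hk => funext fun i => whiteBlue_injective (congrFun hk i)) _ _ ?_ ?_).symm
      · intro a' ha'
        refine not_not.mp fun h0 => ha' ?_
        -- Red is absent from the rest of the boundary of this crossing, so `a'` is white and blue.
        have hc := latticeWeight_count hU (right_ne_zero_of_mul h0) red
        rw [labelCount_const_of_ne (by decide), labelCount_const_of_ne (by decide),
          labelCount_const_of_ne (by decide)] at hc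
        have : ∀ i, ∃ c, whiteBlue c = a' i := fun i => by
          have hr := labelCount_eq_zero.mp (by omega : labelCount red a' = 0) i
          cases hi : a' i
          · exact ⟨true, rfl⟩
          · exact absurd hi hr
          · exact ⟨false, rfl⟩
        choose k hk using this
        exact ⟨k, funext hk⟩
      · intro k
        rw [one_mul, ← aeval_puzzleCoeff, ← waveFunction_eq_whiteBlue hq hx]
        split_ifs with hk
        · rfl
        · refine not_not.mp fun h0 => hk ?_
          have h1 := right_ne_zero_of_mul (Ne.symm h0)
          rw [waveFunction_eq_whiteBlue hq hx] at h1
          -- The `n` white labels on top all come from `k`, so `H_k` vanishes unless `k` has `n`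
          -- particles.
          have hc := latticeWeight_count hU h1 white
          rw [labelCount_const_of_ne (by decide), labelCount_const_of_ne (by decide),
            labelCount_const] at hc
          rw [numParticles_eq_labelCount, ← labelCount_comp whiteBlue_injective]
          simpa [whiteBlue] using hc
    · intro _ x' b' h0
      have hb' := puzzle_bottom_ne_blue h (right_ne_zero_of_mul (left_ne_zero_of_mul h0))
      have h1 := left_ne_zero_of_mul (left_ne_zero_of_mul h0)
      have hc := latticeWeight_count (fun _ _ => columnCrossingWeight_conserving _ _ _) h1 blue
      rw [labelCount_const, labelCount_eq_zero.mpr hwb, labelCount_eq_zero.mpr hb'] at hc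
      obtain rfl : x' = fun _ => blue := labelCount_eq_card.mp hc.symm
      refine ⟨rfl, rfl, by_contra fun hne => h1 ?_⟩
      rw [columnCrossing_frozen hx hb', if_neg hne]
  · intro a' x' b' h0
    obtain ⟨rfl, rfl⟩ := puzzle_frozen hwb (right_ne_zero_of_mul (left_ne_zero_of_mul h0))
    -- The `n` red labels of `m` must leave through the `n` spectral lines, making all of them red.
    have hc := latticeWeight_count hU (left_ne_zero_of_mul (left_ne_zero_of_mul h0)) red
    rw [labelCount_const_of_ne (by decide), labelCount_const_of_ne (by decide)] at hc
    have h2 : labelCount red (fun i => redBlue (m i)) = labelCount true m :=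
      labelCount_comp redBlue_injective true m
    rw [h2, ← numParticles_eq_labelCount, hm] at hc
    exact ⟨rfl, labelCount_eq_card.mp (by omega), rfl⟩

end ProductRule

/-! ### Constancy of the sign of puzzles with given boundary -/

section SignPositivity

open PuzzleLabel

/-- The polynomial `p`, multiplied by the sign of parity `e`, has non-negative coefficients. -/
def HasSign (e : ZMod 2) (p : ℤ[X]) : Prop :=
  ∀ d, 0 ≤ (if e = 0 then 1 else -1) * p.coeff d

theorem HasSign.zero (e : ZMod 2) : HasSign e 0 := fun d => by simp

theorem HasSign.sum {ι : Type*} {s : Finset ι} {e : ZMod 2} {f : ι → ℤ[X]}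
    (h : ∀ i ∈ s, HasSign e (f i)) : HasSign e (∑ i ∈ s, f i) := fun d => by
  rw [finsetSum_coeff, Finset.mul_sum]
  exact Finset.sum_nonneg fun i hi => h i hi d

theorem HasSign.mul {e f : ZMod 2} {p r : ℤ[X]} (hp : HasSign e p) (hr : HasSign f r) :
    HasSign (e + f) (p * r) := fun d => by
  have hs : ∀ e f : ZMod 2, (if e + f = 0 then (1 : ℤ) else -1) =
      (if e = 0 then 1 else -1) * if f = 0 then 1 else -1 := by decide
  rw [coeff_mul, hs, Finset.mul_sum]
  refine Finset.sum_nonneg fun i _ => ?_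
  rw [mul_mul_mul_comm]
  exact mul_nonneg (hp _) (hr _)

/-- Parities need only agree on nonzero terms, where conservation is available. -/
theorem HasSign.congr {e f : ZMod 2} {p : ℤ[X]} (hp : HasSign e p) (h : p ≠ 0 → e = f) :
    HasSign f p := by
  by_cases h0 : p = 0
  · rw [h0]
    exact HasSign.zero f
  · rwa [← h h0]

theorem HasSign.one : HasSign 0 1 := fun d => by
  rw [if_pos rfl, one_mul, coeff_one]
  split_ifs <;> norm_num

theorem HasSign.X : HasSign 0 X := fun d => by
  rw [if_pos rfl, one_mul, coeff_X]
  split_ifs <;> norm_num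

theorem HasSign.neg {p : ℤ[X]} (hp : HasSign 0 p) : HasSign 1 (-p) := fun d => by
  simpa using hp d

/-- The indicator of an equality of labels, modulo two. -/
def labelParity (Y a : PuzzleLabel) : ZMod 2 := if a = Y then 1 else 0

/-- The number of occurrences of a label, modulo two. -/
def countParity (Y : PuzzleLabel) {n : ℕ} (u : Fin n → PuzzleLabel) : ZMod 2 :=
  ∑ i, labelParity Y (u i)

/-- The parity of the number of pairs of a blue label followed by a red one, plus the sum of the
positions, counted from the end, of the white labels. -/
def stringParity : ∀ {n : ℕ}, (Fin n → PuzzleLabel) → ZMod 2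
  | 0, _ => 0
  | n + 1, u => labelParity blue (u 0) * countParity red (fun i => u i.succ) +
      n * labelParity white (u 0) + stringParity fun i => u i.succ

theorem countParity_eq (Y : PuzzleLabel) {n : ℕ} (u : Fin n → PuzzleLabel) :
    countParity Y u = (labelCount Y u : ZMod 2) := by
  simp [countParity, labelCount, labelParity]

theorem countParity_succ (Y : PuzzleLabel) {n : ℕ} (u : Fin (n + 1) → PuzzleLabel) :
    countParity Y u = labelParity Y (u 0) + countParity Y fun i => u i.succ :=
  Fin.sum_univ_succ _

theorem labelParity_eq (Y a : PuzzleLabel) :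
    labelParity Y a = ((if a = Y then 1 else 0 : ℕ) : ZMod 2) := by
  simp [labelParity]

/-- The parity of the sign of a tile, in a form which is additive along rows. -/
def tileParity (a b a' b' : PuzzleLabel) : ZMod 2 :=
  1 + labelParity white a + labelParity white b + labelParity blue a * labelParity red b +
    labelParity blue b' * labelParity red a'

theorem tileWeight_hasSign (a b a' b' : PuzzleLabel) :
    HasSign (tileParity a b a' b') (tileWeight X a b a' b') := by
  cases a <;> cases b <;> cases a' <;> cases b' <;>
    first
    | exact HasSign.zero _
    | exact HasSign.one
    | exact HasSign.X
    | exact HasSign.one.neg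
    | exact HasSign.X.neg

/-- The parity of the sign of a row of a puzzle. -/
def rowParity {n : ℕ} (a : PuzzleLabel) (u : Fin n → PuzzleLabel) (a' : PuzzleLabel)
    (t : Fin n → PuzzleLabel) : ZMod 2 :=
  stringParity u + stringParity t + n + n * labelParity white a + countParity white u +
    labelParity blue a * countParity red u + countParity blue t * labelParity red a'

theorem rowWeight_hasSign {n : ℕ} (a a' : PuzzleLabel) (u t : Fin n → PuzzleLabel) :
    HasSign (rowParity a u a' t) (rowWeight (fun _ => tileWeight (X : ℤ[X])) a u a' t) := by
  have two : (2 : ZMod 2) = 0 := by decide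
  induction n generalizing a with
  | zero =>
    rw [rowWeight, chainProd_zero, Matrix.one_apply]
    split_ifs
    · convert HasSign.one
      simp [rowParity, stringParity, countParity]
    · exact HasSign.zero _
  | succ n ih =>
    rw [rowWeight_succ]
    refine HasSign.sum fun c _ =>
      ((tileWeight_hasSign a (u 0) c (t 0)).mul (ih c _ _)).congr fun h0 => ?_
    have h1 := (tileWeight_conserving (X : ℤ[X]) _ _ _ _ (left_ne_zero_of_mul h0)).count
    have h2 := rowWeight_count (fun _ => tileWeight_conserving (X : ℤ[X]))
      (right_ne_zero_of_mul h0) red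
    have hb := congrArg (Nat.cast : ℕ → ZMod 2) (h1 blue)
    have hw := congrArg (Nat.cast : ℕ → ZMod 2) (h1 white)
    have hr := congrArg (Nat.cast : ℕ → ZMod 2) h2
    simp only [Nat.cast_add, ← labelParity_eq, ← countParity_eq] at hb hw hr
    simp only [rowParity, tileParity, stringParity, countParity_succ, Nat.cast_succ]
    -- Passing from `a` to `c` is corrected by blue and white conservation at the first vertex and
    -- red conservation along the rest of the row; what remains occurs twice.
    linear_combination
      (-countParity red (fun i => u i.succ)) * hb - (n : ZMod 2) * hw +
      labelParity blue (t 0) * hr -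
      (labelParity blue (t 0) * countParity red (fun i => u i.succ) +
        n * labelParity white (t 0)) * two

/-- The potential of each intermediate string `m` enters once from the row above it and once from
the rows below, and cancels modulo two. The existential must be uniform in `t` for the induction to
sum over `m`. -/
theorem latticeWeight_hasSign {R C : ℕ} (l r : Fin R → PuzzleLabel) (b : Fin C → PuzzleLabel) :
    ∃ e : ZMod 2, ∀ t, HasSign (e + stringParity t)
      (latticeWeight (fun _ _ => tileWeight (X : ℤ[X])) l b r t) := by
  have two : (2 : ZMod 2) = 0 := by decide
  induction R with
  | zero =>
    refine ⟨stringParity b, fun t => ?_⟩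
    rw [latticeWeight_zero]
    split_ifs with h
    · refine HasSign.one.congr fun _ => ?_
      rw [h]
      linear_combination (-stringParity b) * two
    · exact HasSign.zero _
  | succ R ih =>
    obtain ⟨e, he⟩ := ih (fun i => l i.succ) fun i => r i.succ
    have count : ∀ Y, ∃ κ : ZMod 2, ∀ m,
        latticeWeight (fun _ _ => tileWeight (X : ℤ[X])) (fun i => l i.succ) b
          (fun i => r i.succ) m ≠ 0 → countParity Y m = κ := fun Y =>
      ⟨countParity Y (fun i => l i.succ) + countParity Y b - countParity Y fun i => r i.succ,
        fun m hm => by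
          have h := congrArg (Nat.cast : ℕ → ZMod 2)
            (latticeWeight_count (fun _ _ => tileWeight_conserving (X : ℤ[X])) hm Y)
          simp only [Nat.cast_add, ← countParity_eq] at h
          linear_combination -h⟩
    obtain ⟨κw, hκw⟩ := count white
    obtain ⟨κr, hκr⟩ := count red
    obtain ⟨κb, hκb⟩ := count blue
    -- This is `e` plus `rowParity` without its two potentials, with the counts in `m` replaced by
    -- their forced values `κ` and the blue count of `t` expressed by conservation in the row.
    refine ⟨e + C + C * labelParity white (l 0) + κw + labelParity blue (l 0) * κr +
      (labelParity blue (l 0) + κb - labelParity blue (r 0)) * labelParity red (r 0),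
      fun t => ?_⟩
    rw [latticeWeight_succ]
    refine HasSign.sum fun m _ => ((rowWeight_hasSign _ _ _ _).mul (he m)).congr fun h0 => ?_
    have hm := right_ne_zero_of_mul h0
    have hb := congrArg (Nat.cast : ℕ → ZMod 2) (rowWeight_count
      (fun _ => tileWeight_conserving (X : ℤ[X])) (left_ne_zero_of_mul h0) blue)
    simp only [Nat.cast_add, ← labelParity_eq, ← countParity_eq] at hb
    rw [rowParity, hκw m hm, hκr m hm]
    linear_combination (-labelParity red (r 0)) * (hb - hκb m hm) + stringParity m * two

end SignPositivity

theorem theorem3p3 (P N n : ℕ) (m : Fin P → Bool) (w l : Fin N → Bool)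
    (hm : numParticles m = n) (hl : numParticles l = numParticles w + n) :
    ((∀ (i : Fin P) (j : Fin N), m i = true → l j = true → (i + 1 : ℕ) + (j + 1 : ℕ) ≤ P) →
      ∀ (K : Type*) [Field K] (q : K) (x : Fin n → K), q ≠ 0 → (∀ i, q * x i ≠ 1) →
        waveFunction q m x * skewWaveFunction q l w x =
          ∑ k : Fin P → Bool with numParticles k = n,
            aeval q (puzzleCoeff k w l m) * waveFunction q k x) ∧
    ∀ k : Fin P → Bool, ∃ ε : ℤ, (ε = 1 ∨ ε = -1) ∧
      ∀ d : ℕ, 0 ≤ ε * (puzzleCoeff k w l m).coeff d := by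
  refine ⟨fun h K _ q x hq hx => ?_, fun k => ?_⟩
  · exact waveFunction_mul_skewWaveFunction m w l hm h hq fun i => sub_ne_zero.mpr (hx i).symm
  · obtain ⟨e, he⟩ := latticeWeight_hasSign (fun i => PuzzleLabel.redBlue (m i))
      (fun i => PuzzleLabel.whiteBlue (k i)) fun j => PuzzleLabel.redWhite (w j.rev)
    -- The sign is read off from the definition of `HasSign`, at parity `e` plus the potential of
    -- the top string.
    refine ⟨_, ?_, fun d => puzzleCoeff_eq_latticeWeight k w l m ▸ he _ d⟩
    split_ifs
    · exact Or.inl rfl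
    · exact Or.inr rfl
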